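/- Let $A$ be a commutative complex Banach algebra (not necessarily unital) with a bounded approximate identity, and let $X$ be a non-empty locally compact Hausdorff space. Let $C_0(X,A)$ be the Banach algebra of all continuous functions $f : X \to A$ vanishing at infinity, with pointwise operations and the norm $\|f\|_\infty = \sup_{x \in X} \|f(x)\|$. Call a complex Banach algebra $\mathcal{B}$ isomorphic to a $C^*$-algebra if there exist a (not necessarily unital) $C^*$-algebra $\mathcal{C}$ and a homomorphism of complex algebras $\varphi : \mathcal{B} \to \mathcal{C}$ that is a bijection and a homeomorphism. Then $C_0(X,A)$ is isomorphic to a $C^*$-algebra if and only if $A$ is isomorphic to a $C^*$-algebra. -/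

import Mathlib

open scoped ZeroAtInfty

universe u

/-- A Banach algebra `A` has a bounded approximate identity: there is a proper filter on `A`
(equivalently, a net in `A`) along which `e * a → a` and `a * e → a` for every `a`, and which is
eventually bounded in norm. -/
def HasBoundedApproximateIdentity (A : Type*) [NonUnitalNormedRing A] : Prop :=
  ∃ (l : Filter A) (M : ℝ), l.IsApproximateUnit ∧ ∀ᶠ e in l, ‖e‖ ≤ M

/-- A complex (not necessarily unital) Banach algebra `A` is isomorphic to a `C⋆`-algebra: there
are a `C⋆`-algebra `B` and a complex algebra homomorphism `A → B` that is a bijection and a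
homeomorphism. (As `B` is in bijection with `A`, taking `B` in the universe of `A` is no
restriction.) -/
def IsIsomorphicToCStarAlgebra (A : Type u) [NonUnitalNormedRing A] [NormedSpace ℂ A] : Prop :=
  ∃ (B : Type u) (_ : NonUnitalCStarAlgebra B) (φ : A →ₙₐ[ℂ] B), IsHomeomorph φ

/-! An isomorphism `φ : A → B` acts pointwise on `C₀(X, A)`, which settles one direction.
Conversely, let `φ : C₀(X, A) → D` be an isomorphism and `f = h • a` with `|h| ≤ 1`, `h x = 1`. In
the commutative `D`, `‖φ f‖ ^ 2^k = ‖φ (f ^ 2^k)‖ ≤ ‖φ‖ ‖a ^ 2^k‖`, so `‖φ f‖` is at most the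
spectral radius of `a`, and `‖a‖ ≤ ‖f‖ ≤ ‖φ⁻¹‖ ‖φ f‖`. Hence the Gelfand transform of `A` is bounded
below. Its range is self-adjoint because characters of `D` preserve the star, so `A` is a closed
star subalgebra of some `C(K)`. -/

open Filter Topology WeakDual
open scoped ENNReal NNReal

/-! ### Characters and norms of squares in C⋆-algebras -/

section CStar

variable {D : Type*} [NonUnitalCStarAlgebra D]

/-- A (possibly zero) multiplicative linear functional on a `C⋆`-algebra preserves the star. -/
theorem NonUnitalAlgHom.map_star_complex (ψ : D →ₙₐ[ℂ] ℂ) (d : D) : ψ (star d) = star (ψ d) := by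
  -- The extension to the unitization is a unital character of a C⋆-algebra, hence star-preserving.
  have h := map_star (Unitization.lift ψ) (d : Unitization ℂ D)
  rwa [← Unitization.inr_star, ← Unitization.lift_symm_apply_apply,
    ← Unitization.lift_symm_apply_apply, Equiv.symm_apply_apply] at h

theorem norm_mul_self_of_commute_star {d : D} (h : Commute (star d) d) :
    ‖d * d‖ = ‖d‖ * ‖d‖ := by
  refine (mul_self_inj (norm_nonneg _) (by positivity)).mp ?_
  calc ‖d * d‖ * ‖d * d‖ = ‖star (star d * d) * (star d * d)‖ := by
        rw [← CStarRing.norm_star_mul_self, star_mul, star_mul, star_star]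
        congr 1
        rw [mul_assoc, mul_assoc, ← mul_assoc (star d) d d, h.eq, mul_assoc d, ← h.eq]
    _ = ‖d‖ * ‖d‖ * (‖d‖ * ‖d‖) := by
        rw [CStarRing.norm_star_mul_self, CStarRing.norm_star_mul_self]

theorem norm_iterate_mul_self (hD : ∀ x y : D, x * y = y * x) (d : D) (k : ℕ) :
    ‖(fun x : D ↦ x * x)^[k] d‖ = ‖d‖ ^ 2 ^ k := by
  induction k with
  | zero => simp
  | succ k ih =>
    rw [Function.iterate_succ_apply', norm_mul_self_of_commute_star (hD _ _), ih, pow_succ,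
      pow_mul, sq]

end CStar

/-! ### Gelfand transform through the unitization -/

section Gelfand

variable (A : Type*) [NonUnitalNormedCommRing A] [NormedSpace ℂ A] [IsScalarTower ℂ A A]
  [SMulCommClass ℂ A A]

/-- The unitization of a commutative normed algebra, with the `ℓ¹` norm. -/
abbrev L1Unitization : Type _ := WithLp 1 (Unitization ℂ A)

noncomputable instance : NormedCommRing (L1Unitization A) :=
  { WithLp.instUnitizationNormedRing (𝕜 := ℂ) (A := A) with
    mul_comm := fun x y ↦ WithLp.ofLp_injective 1 (mul_comm x.ofLp y.ofLp) }

instance : NormOneClass (L1Unitization A) where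
  norm_one := by
    rw [WithLp.unitization_norm_def]
    change ‖(1 : Unitization ℂ A).fst‖ + ‖(1 : Unitization ℂ A).snd‖ = 1
    simp

/-- The inclusion of a commutative normed algebra into its unitization. -/
noncomputable def L1Unitization.inr : A →ₙₐ[ℂ] L1Unitization A :=
  ((WithLp.unitizationAlgEquiv (𝕜 := ℂ) (A := A) ℂ).symm : Unitization ℂ A →ₙₐ[ℂ] _).comp
    (Unitization.inrNonUnitalAlgHom ℂ A)

theorem L1Unitization.norm_inr (a : A) : ‖L1Unitization.inr A a‖ = ‖a‖ :=
  WithLp.unitization_norm_inr a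

theorem L1Unitization.inr_iterate_mul_self (a : A) (k : ℕ) :
    L1Unitization.inr A ((fun x : A ↦ x * x)^[k] a) = L1Unitization.inr A a ^ 2 ^ k := by
  induction k with
  | zero => simp
  | succ k ih => rw [Function.iterate_succ_apply', map_mul, ih, pow_succ, pow_mul, sq]

variable [CompleteSpace A]

/-- The Gelfand transform of a commutative Banach algebra, not necessarily unital, as functions on
the character space of the unitization. -/
noncomputable def nonUnitalGelfandTransform :
    A →ₙₐ[ℂ] C(characterSpace ℂ (L1Unitization A), ℂ) :=
  (gelfandTransform ℂ (L1Unitization A) : L1Unitization A →ₙₐ[ℂ] _).comp (L1Unitization.inr A)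

variable {A}

/-- The unital transform preserves spectra, and in `C(K)` the norm is the spectral radius. -/
theorem nnnorm_nonUnitalGelfandTransform (a : A) :
    (‖nonUnitalGelfandTransform A a‖₊ : ℝ≥0∞) = spectralRadius ℂ (L1Unitization.inr A a) := by
  have h : ∀ u : L1Unitization A,
      (‖gelfandTransform ℂ (L1Unitization A) u‖₊ : ℝ≥0∞) = spectralRadius ℂ u := fun u ↦ by
    rw [← IsStarNormal.spectralRadius_eq_nnnorm, spectralRadius, spectralRadius,
      spectrum.gelfandTransform_eq]
  exact h _

theorem norm_nonUnitalGelfandTransform_le (a : A) : ‖nonUnitalGelfandTransform A a‖ ≤ ‖a‖ := by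
  have h := nnnorm_nonUnitalGelfandTransform a ▸
    spectrum.spectralRadius_le_nnnorm (𝕜 := ℂ) (L1Unitization.inr A a)
  rw [← L1Unitization.norm_inr A a]
  exact_mod_cast h

/-- Take `2^k`-th roots in Gelfand's spectral radius formula: the constant `C` tends to one. -/
theorem le_nnnorm_nonUnitalGelfandTransform {a : A} {C r : ℝ≥0} (hC : C ≠ 0)
    (h : ∀ k : ℕ, r ^ 2 ^ k ≤ C * ‖(fun x : A ↦ x * x)^[k] a‖₊) :
    r ≤ ‖nonUnitalGelfandTransform A a‖₊ := by
  have hpow : Tendsto (fun k : ℕ ↦ 2 ^ k) atTop atTop :=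
    tendsto_pow_atTop_atTop_of_one_lt one_lt_two
  have hrad := (spectrum.pow_nnnorm_pow_one_div_tendsto_nhds_spectralRadius
    (L1Unitization.inr A a)).comp hpow
  have hconst : Tendsto (fun n : ℕ ↦ ((C ^ (1 / n : ℝ) : ℝ≥0) : ℝ≥0∞)) atTop (𝓝 1) := by
    have h0 : Tendsto (fun n : ℕ ↦ C ^ (1 / n : ℝ)) atTop (𝓝 (C ^ (0 : ℝ))) :=
      (NNReal.continuousAt_rpow (Or.inl hC)).tendsto.comp
        (tendsto_const_nhds.prodMk_nhds tendsto_one_div_atTop_nhds_zero_nat)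
    rw [NNReal.rpow_zero] at h0
    exact ENNReal.tendsto_coe.mpr h0
  have hlim := ENNReal.Tendsto.mul (hconst.comp hpow) (Or.inl one_ne_zero) hrad
    (Or.inr ENNReal.one_ne_top)
  rw [one_mul, ← nnnorm_nonUnitalGelfandTransform] at hlim
  have hle := ge_of_tendsto' hlim (b := (r : ℝ≥0∞)) fun k ↦ ?_
  · exact_mod_cast hle
  have hn : ((2 ^ k : ℕ) : ℝ) ≠ 0 := by positivity
  have hk : r ^ 2 ^ k ≤ C * ‖L1Unitization.inr A a ^ 2 ^ k‖₊ := by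
    rw [← L1Unitization.inr_iterate_mul_self]
    refine (h k).trans_eq ?_
    rw [← NNReal.coe_inj]
    push_cast
    rw [L1Unitization.norm_inr]
  have hroot : r ≤ C ^ (1 / (2 ^ k : ℕ) : ℝ) *
      ‖L1Unitization.inr A a ^ 2 ^ k‖₊ ^ (1 / (2 ^ k : ℕ) : ℝ) := by
    rw [← NNReal.mul_rpow, one_div]
    calc r = (r ^ 2 ^ k) ^ (((2 ^ k : ℕ) : ℝ)⁻¹) := by
          rw [← NNReal.rpow_natCast, NNReal.rpow_rpow_inv hn]
      _ ≤ _ := NNReal.rpow_le_rpow hk (by positivity)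
  have hroot' := ENNReal.coe_le_coe.mpr hroot
  rwa [ENNReal.coe_mul, ENNReal.coe_rpow_of_nonneg ‖L1Unitization.inr A a ^ 2 ^ k‖₊
    (by positivity)] at hroot'

/-- If the Gelfand transform is bounded below and the set of transforms is closed under complex
conjugation, then the algebra is isomorphic to a `C⋆`-algebra. -/
theorem isIsomorphicToCStarAlgebra_of_gelfand (K : ℝ≥0)
    (hK : ∀ a : A, ‖a‖ ≤ K * ‖nonUnitalGelfandTransform A a‖)
    (hstar : ∀ a : A, ∃ b : A, ∀ χ : A →ₙₐ[ℂ] ℂ, χ b = star (χ a)) :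
    IsIsomorphicToCStarAlgebra A := by
  let G := nonUnitalGelfandTransform A
  have hG : Continuous G :=
    AddMonoidHomClass.continuous_of_bound G 1
      fun a ↦ by simpa using norm_nonUnitalGelfandTransform_le a
  have hanti : AntilipschitzWith K G := AddMonoidHomClass.antilipschitz_of_bound G hK
  have huc : UniformContinuous G := uniformContinuous_addMonoidHom_of_continuous hG
  have hcl : IsClosedEmbedding G := hanti.isClosedEmbedding huc
  let S : NonUnitalStarSubalgebra ℂ C(characterSpace ℂ (L1Unitization A), ℂ) :=
    { NonUnitalAlgHom.range G with
      star_mem' := by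
        rintro _ ⟨a, rfl⟩
        obtain ⟨b, hb⟩ := hstar a
        refine ⟨b, ContinuousMap.ext fun χ ↦ ?_⟩
        -- A character of the unitization may restrict to zero on `A`; `hstar` covers this case too.
        exact hb ((χ : L1Unitization A →ₙₐ[ℂ] ℂ).comp (L1Unitization.inr A)) }
  have : IsClosed (S : Set C(characterSpace ℂ (L1Unitization A), ℂ)) := hcl.isClosed_range
  refine ⟨S, inferInstance, NonUnitalAlgHom.codRestrict G S.toNonUnitalSubalgebra fun a ↦ ⟨a, rfl⟩, ?_⟩
  exact hcl.isEmbedding.toHomeomorph.isHomeomorph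

end Gelfand

/-! ### Transfer between `A` and `C₀(X, A)` -/

section ZeroAtInfty

variable {X : Type*} [TopologicalSpace X]

/-- Composition with a continuous homomorphism, as a map between algebras of functions vanishing
at infinity. -/
def ZeroAtInftyContinuousMap.mapNonUnitalAlgHom {A B : Type*} [NonUnitalNormedRing A]
    [NormedSpace ℂ A] [NonUnitalNormedRing B] [NormedSpace ℂ B]
    (φ : A →ₙₐ[ℂ] B) (hφ : Continuous φ) : C₀(X, A) →ₙₐ[ℂ] C₀(X, B) where
  toFun f := ⟨⟨fun x ↦ φ (f x), hφ.comp f.continuous⟩, by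
    simpa [Function.comp_def] using (hφ.tendsto 0).comp (zero_at_infty f)⟩
  map_smul' c f := by ext x; simp
  map_zero' := by ext x; simp
  map_add' f g := by ext x; simp
  map_mul' f g := by ext x; simp

theorem ZeroAtInftyContinuousMap.norm_apply_le {A : Type*} [NormedAddCommGroup A]
    (f : C₀(X, A)) (x : X) : ‖f x‖ ≤ ‖f‖ :=
  f.toBCF.norm_coe_le_norm x

theorem ZeroAtInftyContinuousMap.norm_le {A : Type*} [NormedAddCommGroup A]
    {f : C₀(X, A)} {C : ℝ} (hC : 0 ≤ C) : ‖f‖ ≤ C ↔ ∀ x, ‖f x‖ ≤ C :=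
  f.toBCF.norm_le hC

theorem ZeroAtInftyContinuousMap.continuous_mapNonUnitalAlgHom {A B : Type*}
    [NonUnitalNormedRing A] [NormedSpace ℂ A] [NonUnitalNormedRing B] [NormedSpace ℂ B]
    (φ : A →ₙₐ[ℂ] B) (hφ : Continuous φ) :
    Continuous (mapNonUnitalAlgHom (X := X) φ hφ) := by
  let L : A →L[ℂ] B := ⟨(φ : A →ₗ[ℂ] B), hφ⟩
  refine AddMonoidHomClass.continuous_of_bound _ ‖L‖ fun f ↦ ?_
  refine (norm_le (by positivity)).mpr fun x ↦ (L.le_opNorm (f x)).trans ?_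
  gcongr
  exact norm_apply_le f x

theorem IsIsomorphicToCStarAlgebra.zeroAtInfty {A : Type*} [NonUnitalNormedRing A]
    [NormedSpace ℂ A] (h : IsIsomorphicToCStarAlgebra A) :
    IsIsomorphicToCStarAlgebra C₀(X, A) := by
  obtain ⟨B, _, φ, hφ⟩ := h
  let e := hφ.homeomorph
  have he : ∀ a, e.symm (φ a) = a := e.symm_apply_apply
  have he' : ∀ b, φ (e.symm b) = b := e.apply_symm_apply
  let φinv : B →ₙₐ[ℂ] A := φ.inverse e.symm he he'
  have hφinv : Continuous φinv := e.symm.continuous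
  let F : C₀(X, A) →ₙₐ[ℂ] C₀(X, B) :=
    ZeroAtInftyContinuousMap.mapNonUnitalAlgHom φ hφ.continuous
  let Finv : C₀(X, B) →ₙₐ[ℂ] C₀(X, A) :=
    ZeroAtInftyContinuousMap.mapNonUnitalAlgHom φinv hφinv
  refine ⟨C₀(X, B), inferInstance, F, ?_⟩
  exact (Homeomorph.mk ⟨F, Finv, fun f ↦ ZeroAtInftyContinuousMap.ext fun x ↦ he _,
    fun f ↦ ZeroAtInftyContinuousMap.ext fun x ↦ he' _⟩
    (ZeroAtInftyContinuousMap.continuous_mapNonUnitalAlgHom φ hφ.continuous)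
    (ZeroAtInftyContinuousMap.continuous_mapNonUnitalAlgHom φinv hφinv)).isHomeomorph

/-- A point of a locally compact Hausdorff space carries every vector as the value of a function
`f = h • a` vanishing at infinity with `h` scalar and bounded by one. -/
theorem ZeroAtInftyContinuousMap.exists_smul_apply_eq [T2Space X] [LocallyCompactSpace X]
    {A : Type*} [NormedAddCommGroup A] [NormedSpace ℂ A] (x : X) (a : A) :
    ∃ (f : C₀(X, A)) (h : X → ℂ), (∀ y, ‖h y‖ ≤ 1) ∧ (∀ y, f y = h y • a) ∧ f x = a := by
  obtain ⟨h, h1, -, hc, h01⟩ := exists_continuous_one_zero_of_isCompact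
    (isCompact_singleton (x := x)) isClosed_empty (Set.disjoint_empty _)
  refine ⟨⟨⟨fun y ↦ (h y : ℂ) • a, by fun_prop⟩, ?_⟩, fun y ↦ h y, fun y ↦ ?_, fun y ↦ rfl, ?_⟩
  · refine HasCompactSupport.is_zero_at_infty (hc.mono fun y hy hy0 ↦ hy ?_)
    simp [hy0]
  · simpa [abs_of_nonneg (h01 y).1] using (h01 y).2
  · have hx : h x = 1 := h1 rfl
    change (h x : ℂ) • a = a
    simp [hx]

theorem iterate_mul_self_smul {A : Type*} [NonUnitalNormedRing A] [NormedSpace ℂ A]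
    [IsScalarTower ℂ A A] [SMulCommClass ℂ A A] (c : ℂ) (a : A) (k : ℕ) :
    (fun x : A ↦ x * x)^[k] (c • a) = c ^ 2 ^ k • (fun x : A ↦ x * x)^[k] a := by
  induction k with
  | zero => simp
  | succ k ih =>
    rw [Function.iterate_succ_apply', Function.iterate_succ_apply', ih, smul_mul_smul_comm,
      pow_succ, pow_mul, sq]

theorem ZeroAtInftyContinuousMap.iterate_mul_self_apply {A : Type*} [NonUnitalNormedRing A]
    (f : C₀(X, A)) (k : ℕ) (x : X) :
    ((fun g : C₀(X, A) ↦ g * g)^[k] f) x = (fun y : A ↦ y * y)^[k] (f x) := by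
  induction k with
  | zero => rfl
  | succ k ih => simp only [Function.iterate_succ_apply', mul_apply, ih]

variable [T2Space X] [LocallyCompactSpace X] [Nonempty X]
  {A : Type*} [NonUnitalNormedCommRing A] [NormedSpace ℂ A] [IsScalarTower ℂ A A]
  [SMulCommClass ℂ A A] [CompleteSpace A]

theorem IsIsomorphicToCStarAlgebra.of_zeroAtInfty (h : IsIsomorphicToCStarAlgebra C₀(X, A)) :
    IsIsomorphicToCStarAlgebra A := by
  obtain ⟨D, _, φ, hφ⟩ := h
  have hD : ∀ p q : D, p * q = q * p := fun p q ↦ by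
    obtain ⟨f, rfl⟩ := hφ.surjective p
    obtain ⟨g, rfl⟩ := hφ.surjective q
    rw [← map_mul, mul_comm, map_mul]
  let x : X := Classical.arbitrary X
  let e := hφ.homeomorph
  have he : ∀ f, e.symm (φ f) = f := e.symm_apply_apply
  have he' : ∀ d, φ (e.symm d) = d := e.apply_symm_apply
  let φinv : D →ₙₐ[ℂ] C₀(X, A) := φ.inverse e.symm he he'
  have hφinv : Continuous φinv := e.symm.continuous
  let L : C₀(X, A) →L[ℂ] D := ⟨(φ : C₀(X, A) →ₗ[ℂ] D), hφ.continuous⟩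
  let Linv : D →L[ℂ] C₀(X, A) := ⟨(φinv : D →ₗ[ℂ] C₀(X, A)), hφinv⟩
  refine isIsomorphicToCStarAlgebra_of_gelfand ‖Linv‖₊ (fun a ↦ ?_) fun a ↦ ?_
  · obtain ⟨f, h, h1, hf, hfx⟩ := ZeroAtInftyContinuousMap.exists_smul_apply_eq x a
    -- The `+ 1` keeps the constant nonzero when `L = 0`.
    have hpow : ∀ k : ℕ, ‖φ f‖₊ ^ 2 ^ k ≤ (‖L‖₊ + 1) * ‖(fun y : A ↦ y * y)^[k] a‖₊ := by
      intro k
      rw [← NNReal.coe_le_coe]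
      push_cast
      have hit : (fun d : D ↦ d * d)^[k] (φ f) = φ ((fun g : C₀(X, A) ↦ g * g)^[k] f) :=
        (Function.Semiconj.iterate_right (f := φ) (fun g ↦ map_mul φ g g) k f).symm
      rw [← norm_iterate_mul_self hD, hit]
      refine (L.le_opNorm _).trans ?_
      gcongr
      · exact le_add_of_nonneg_right zero_le_one
      · refine (ZeroAtInftyContinuousMap.norm_le (norm_nonneg _)).mpr fun y ↦ ?_
        rw [ZeroAtInftyContinuousMap.iterate_mul_self_apply, hf, iterate_mul_self_smul, norm_smul,
          norm_pow]
        exact mul_le_of_le_one_left (norm_nonneg _) (pow_le_one₀ (norm_nonneg _) (h1 y))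
    have hr : ‖φ f‖ ≤ ‖nonUnitalGelfandTransform A a‖ :=
      le_nnnorm_nonUnitalGelfandTransform (by positivity) hpow
    calc ‖a‖ = ‖f x‖ := by rw [hfx]
      _ ≤ ‖f‖ := ZeroAtInftyContinuousMap.norm_apply_le f x
      _ = ‖Linv (φ f)‖ := congrArg norm (he f).symm
      _ ≤ ‖Linv‖ * ‖φ f‖ := Linv.le_opNorm _
      _ ≤ ‖Linv‖ * ‖nonUnitalGelfandTransform A a‖ := by gcongr
  · obtain ⟨f, -, -, -, hfx⟩ := ZeroAtInftyContinuousMap.exists_smul_apply_eq x a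
    -- The star of `D` is carried to `C₀(X, A)` and evaluated at `x`; `χ` pulls back to a functional
    -- on `D`.
    refine ⟨φinv (star (φ f)) x, fun χ ↦ ?_⟩
    let ev : C₀(X, A) →ₙₐ[ℂ] A :=
      { toFun := fun g ↦ g x
        map_smul' := fun _ _ ↦ rfl
        map_zero' := rfl
        map_add' := fun _ _ ↦ rfl
        map_mul' := fun _ _ ↦ rfl }
    have key := NonUnitalAlgHom.map_star_complex (χ.comp (ev.comp φinv)) (φ f)
    have hev : (χ.comp (ev.comp φinv)) (φ f) = χ a := by
      rw [← hfx]
      exact congrArg (fun g : C₀(X, A) ↦ χ (g x)) (he f)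
    rw [hev] at key
    exact key

end ZeroAtInfty

theorem mainTheorem1 {X : Type*} [TopologicalSpace X] [T2Space X] [LocallyCompactSpace X]
    [Nonempty X]
    {A : Type*} [NonUnitalNormedCommRing A] [NormedSpace ℂ A] [IsScalarTower ℂ A A]
    [SMulCommClass ℂ A A] [CompleteSpace A]
    (hA : HasBoundedApproximateIdentity A) :
    IsIsomorphicToCStarAlgebra C₀(X, A) ↔ IsIsomorphicToCStarAlgebra A := by
  exact ⟨IsIsomorphicToCStarAlgebra.of_zeroAtInfty, IsIsomorphicToCStarAlgebra.zeroAtInfty⟩
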